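/- Let $T$ be the binary rooted tree, with vertex set $\{0,1\}^*$ and edges $(w,wx)$, $w\in\{0,1\}^*$, $x\in\{0,1\}$, and let $\Omega=\{0,1,2\}^{\mathbb N}$ with the shift $\tau(\omega_1\omega_2\omega_3\ldots)=\omega_2\omega_3\ldots$. Let $a\in Aut(T)$ be given by $a(0v)=1v$, $a(1v)=0v$. For $\omega\in\Omega$ define $b_\omega,c_\omega,d_\omega\in Aut(T)$ recursively by $$b_\omega(0v)=0\,\beta(\omega_1)(v),\quad c_\omega(0v)=0\,\zeta(\omega_1)(v),\quad d_\omega(0v)=0\,\delta(\omega_1)(v),$$ $$b_\omega(1v)=1\,b_{\tau\omega}(v),\quad c_\omega(1v)=1\,c_{\tau\omega}(v),\quad d_\omega(1v)=1\,d_{\tau\omega}(v),$$ where $(\beta(0),\beta(1),\beta(2))=(a,a,e)$, $(\zeta(0),\zeta(1),\zeta(2))=(a,e,a)$, $(\delta(0),\delta(1),\delta(2))=(e,a,a)$, and $e$ is the identity. Let $G_\omega=\langle a,b_\omega,c_\omega,d_\omega\rangle\le Aut(T)$, and write $H'''$ for the third derived subgroup of a group $H$. For $g\in Aut(T)$ and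 $x\in\{0,1\}$ let $g_x\in Aut(T)$ be the section of $g$ at $x$, so that $g(xv)=g(x)\,g_x(v)$ for all $v$, and let $\sigma_g$ be the permutation of $\{0,1\}$ induced by $g$ on the first level. Let $$\phi_\omega:G_\omega\to S_2\ltimes(G_{\tau\omega}\times G_{\tau\omega}),\qquad g\mapsto\sigma_g\,(g_0,g_1),$$ be the resulting injective homomorphism (the first-level decomposition). For a subgroup $G\le Aut(T)$ and a vertex $v$, let $Rist_G(v)$ be the subgroup of those elements of $G$ that fix every vertex outside the subtree of the words with prefix $v$, and let $Rist_G(n)$ be the subgroup generated by all $Rist_G(v)$ with $|v|=n$. The group $G$ is a branch group if it acts transitively on every level of $T$ and $Rist_G(n)$ has finite index in $G$ for every $n\ge 1$. Then: (1) For every $\omega\in\Omega$, $\;G_{\tau\omega}'''\times G_{\tau\omega}'''\le\phi_\omega(G_\omega''')$. (2) If each of the letters $0,1,2$ occurs infinitely often in $\omega\in\Omega$, then $G_\omega$ is a branch group; in particular, $Rist_{G_\omega}(n)$ has finite index in $G_\omega$ for every $n\ge1$. -/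

import Mathlib

namespace GrigBranch

/-! ### Automorphisms of the `d`-ary rooted tree -/

/-- The (directed) edges `(w, wx)` of the `d`-ary rooted tree, whose vertices are the finite words
over `{0, …, d-1}`; the root is the empty word. -/
def treeEdge (d : ℕ) (u v : List (Fin d)) : Prop := ∃ x : Fin d, v = u ++ [x]

/-- `Aut(T_d)`: the permutations `g` of the vertices such that `(g u, g v)` is an edge if and only
if `(u, v)` is. Such a `g` fixes the root, the only vertex without an incoming edge. The product is
composition, `(g * h) v = g (h v)`. -/
abbrev TreeAut (d : ℕ) : Type := treeEdge d ≃r treeEdge d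

section Basic

variable {d : ℕ}

theorem TreeAut.map_nil (g : TreeAut d) : g [] = [] := by
  rcases List.eq_nil_or_concat (g []) with h | ⟨u, x, h⟩
  · exact h
  · have hu : treeEdge d u (g []) := ⟨x, by simpa using h⟩
    have h2 : treeEdge d (g⁻¹ u) [] := by
      have := (g⁻¹).map_rel_iff.2 hu
      rwa [RelIso.inv_apply_self] at this
    obtain ⟨y, hy⟩ := h2
    simp at hy

theorem TreeAut.map_snoc (g : TreeAut d) (u : List (Fin d)) (x : Fin d) :
    ∃ y : Fin d, g (u ++ [x]) = g u ++ [y] :=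
  g.map_rel_iff.2 ⟨x, rfl⟩

theorem TreeAut.length_map (g : TreeAut d) (u : List (Fin d)) : (g u).length = u.length := by
  induction u using List.reverseRecOn with
  | nil => simp [TreeAut.map_nil]
  | append_singleton u x ih =>
    obtain ⟨y, hy⟩ := g.map_snoc u x
    simp [hy, ih]

/-- The action of `g` on the first level, as a map: `σ_g(x)` is the letter `y` with `g x = y`. -/
def rootFun (g : TreeAut d) (x : Fin d) : Fin d :=
  (g [x]).head (by
    intro h
    have := g.length_map [x]
    simp [h] at this)

/-- The section of `g` at `x`, as a map: `g (xv)` with its first letter deleted. -/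
def sectionFun (g : TreeAut d) (x : Fin d) (v : List (Fin d)) : List (Fin d) := (g (x :: v)).tail

theorem TreeAut.map_cons (g : TreeAut d) (x : Fin d) (v : List (Fin d)) :
    g (x :: v) = rootFun g x :: sectionFun g x v := by
  have key : ∃ w, g (x :: v) = rootFun g x :: w := by
    induction v using List.reverseRecOn with
    | nil => exact ⟨(g [x]).tail, by simp [rootFun]⟩
    | append_singleton u y ih =>
      obtain ⟨w, hw⟩ := ih
      obtain ⟨z, hz⟩ := g.map_snoc (x :: u) y
      refine ⟨w ++ [z], ?_⟩
      rw [← List.cons_append, hz, hw, List.cons_append]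
  obtain ⟨w, hw⟩ := key
  rw [sectionFun, hw, List.tail_cons]

theorem rootFun_mul (g h : TreeAut d) (x : Fin d) :
    rootFun (g * h) x = rootFun g (rootFun h x) := by
  have h1 := TreeAut.map_cons (g * h) x []
  rw [RelIso.mul_apply, TreeAut.map_cons h, TreeAut.map_cons g] at h1
  exact (List.cons.inj h1).1.symm

theorem sectionFun_mul (g h : TreeAut d) (x : Fin d) (v : List (Fin d)) :
    sectionFun (g * h) x v = sectionFun g (rootFun h x) (sectionFun h x v) := by
  have h1 := TreeAut.map_cons (g * h) x v
  rw [RelIso.mul_apply, TreeAut.map_cons h, TreeAut.map_cons g] at h1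
  exact (List.cons.inj h1).2.symm

theorem rootFun_one (x : Fin d) : rootFun (1 : TreeAut d) x = x := by
  simp [rootFun]

theorem sectionFun_one (x : Fin d) (v : List (Fin d)) :
    sectionFun (1 : TreeAut d) x v = v := by
  simp [sectionFun]

/-- The permutation `σ_g` of the letters describing the action of `g` on the first level. -/
def rootPerm (g : TreeAut d) : Equiv.Perm (Fin d) where
  toFun := rootFun g
  invFun := rootFun g⁻¹
  left_inv x := by rw [← rootFun_mul, inv_mul_cancel, rootFun_one]
  right_inv x := by rw [← rootFun_mul, mul_inv_cancel, rootFun_one]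

theorem treeEdge_sectionFun (g : TreeAut d) (x : Fin d) {u v : List (Fin d)}
    (h : treeEdge d u v) : treeEdge d (sectionFun g x u) (sectionFun g x v) := by
  obtain ⟨y, rfl⟩ := h
  obtain ⟨z, hz⟩ := g.map_snoc (x :: u) y
  rw [List.cons_append, TreeAut.map_cons, TreeAut.map_cons, List.cons_append] at hz
  exact ⟨z, (List.cons.inj hz).2⟩

/-- The section `g_x`, an automorphism of the tree; it is determined by
`g (xv) = g(x) g_x(v)` (see `map_cons_eq`). -/
def treeSection (g : TreeAut d) (x : Fin d) : TreeAut d where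
  toFun := sectionFun g x
  invFun := sectionFun g⁻¹ (rootPerm g x)
  left_inv v := by
    change sectionFun g⁻¹ (rootFun g x) (sectionFun g x v) = v
    rw [← sectionFun_mul, inv_mul_cancel, sectionFun_one]
  right_inv v := by
    change sectionFun g x (sectionFun g⁻¹ (rootFun g x) v) = v
    have hx : x = rootFun g⁻¹ (rootFun g x) := ((rootPerm g).left_inv x).symm
    conv_lhs => arg 2; rw [hx]
    rw [← sectionFun_mul, mul_inv_cancel, sectionFun_one]
  map_rel_iff' := by
    intro u v
    refine ⟨fun h => ?_, fun h => treeEdge_sectionFun g x h⟩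
    have h2 := treeEdge_sectionFun g⁻¹ (rootFun g x) h
    change treeEdge d (sectionFun g⁻¹ (rootFun g x) (sectionFun g x u))
      (sectionFun g⁻¹ (rootFun g x) (sectionFun g x v)) at h2
    rwa [← sectionFun_mul, ← sectionFun_mul, inv_mul_cancel, sectionFun_one,
      sectionFun_one] at h2

theorem map_cons_eq (g : TreeAut d) (x : Fin d) (v : List (Fin d)) :
    g (x :: v) = rootPerm g x :: treeSection g x v :=
  TreeAut.map_cons g x v

theorem rootPerm_mul (g h : TreeAut d) : rootPerm (g * h) = rootPerm g * rootPerm h :=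
  Equiv.ext fun x => rootFun_mul g h x

theorem treeSection_mul (g h : TreeAut d) (x : Fin d) :
    treeSection (g * h) x = treeSection g (rootPerm h x) * treeSection h x :=
  RelIso.ext fun v => sectionFun_mul g h x v

theorem rootPerm_one : rootPerm (1 : TreeAut d) = 1 :=
  Equiv.ext fun x => rootFun_one x

theorem treeSection_one (x : Fin d) : treeSection (1 : TreeAut d) x = 1 :=
  RelIso.ext fun v => sectionFun_one x v

theorem treeAut_ext {g h : TreeAut d} (h1 : rootPerm g = rootPerm h)
    (h2 : ∀ x, treeSection g x = treeSection h x) : g = h := by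
  refine RelIso.ext fun v => ?_
  cases v with
  | nil => rw [TreeAut.map_nil, TreeAut.map_nil]
  | cons x v => rw [map_cons_eq, map_cons_eq, h1, h2]

/-! ### Rigid stabilizers and branch groups -/

/-- The rigid stabilizer `Rist_G(v)`, as a subgroup of `G`: the elements whose support (the set of
vertices that are not fixed) is contained in the subtree `T_v` of the words with prefix `v`. -/
def rist (G : Subgroup (TreeAut d)) (v : List (Fin d)) : Subgroup G where
  carrier := {g | {w | (g : TreeAut d) w ≠ w} ⊆ {w | v <+: w}}
  one_mem' := by
    intro w hw
    exact absurd rfl hw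
  mul_mem' := by
    intro g h hg hh w hw
    by_cases h1 : (h : TreeAut d) w = w
    · refine hg ?_
      intro h2
      apply hw
      change (g : TreeAut d) ((h : TreeAut d) w) = w
      rw [h1, h2]
    · exact hh h1
  inv_mem' := by
    intro g hg w hw
    refine hg ?_
    intro h2
    apply hw
    change (g : TreeAut d)⁻¹ w = w
    conv_lhs => rw [← h2]
    exact RelIso.inv_apply_self _ _

/-- The rigid stabilizer `Rist_G(n)` of level `n`: the subgroup of `G` generated by the rigid
stabilizers of the vertices of level `n`. -/
def ristLevel (G : Subgroup (TreeAut d)) (n : ℕ) : Subgroup G :=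
  ⨆ (v : List (Fin d)) (_ : v.length = n), rist G v

/-- `G` acts transitively on each level of the tree. -/
def LevelTransitive (G : Subgroup (TreeAut d)) : Prop :=
  ∀ u v : List (Fin d), u.length = v.length → ∃ g ∈ G, g u = v

/-- A group of automorphisms of the tree is a branch group if it is level transitive and all its
rigid level stabilizers have finite index. -/
def IsBranch (G : Subgroup (TreeAut d)) : Prop :=
  LevelTransitive G ∧ ∀ n : ℕ, 1 ≤ n → (ristLevel G n).FiniteIndex

end Basic

/-! ### The groups `G_ω` -/

/-- `Ω = {0,1,2}^ℕ`; the first letter of `ω` is `ω 0`. -/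
abbrev Omega : Type := ℕ → Fin 3

/-- The shift `τ`. -/
def shift (ω : Omega) : Omega := fun n => ω (n + 1)

/-- `Ω_∞`: the sequences in which each of the three letters occurs infinitely often. -/
def OmegaInf : Set Omega := {ω | ∀ i : Fin 3, {n : ℕ | ω n = i}.Infinite}

/-- `a (0v) = 1v`, `a (1v) = 0v`. -/
def aFun : List (Fin 2) → List (Fin 2)
  | [] => []
  | x :: v => Equiv.swap 0 1 x :: v

theorem aFun_aFun (v : List (Fin 2)) : aFun (aFun v) = v := by
  cases v <;> simp [aFun]

theorem treeEdge_aFun {u v : List (Fin 2)} (h : treeEdge 2 u v) :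
    treeEdge 2 (aFun u) (aFun v) := by
  obtain ⟨y, rfl⟩ := h
  cases u with
  | nil => exact ⟨Equiv.swap 0 1 y, rfl⟩
  | cons x u => exact ⟨y, rfl⟩

/-- The automorphism `a`. -/
def a : TreeAut 2 where
  toFun := aFun
  invFun := aFun
  left_inv := aFun_aFun
  right_inv := aFun_aFun
  map_rel_iff' := by
    intro u v
    refine ⟨fun h => ?_, treeEdge_aFun⟩
    have h2 := treeEdge_aFun h
    change treeEdge 2 (aFun (aFun u)) (aFun (aFun v)) at h2
    rwa [aFun_aFun, aFun_aFun] at h2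

/-- The common recursion of `b_ω`, `c_ω`, `d_ω`:
`g_ω (0v) = 0 ε(ω_1)(v)` and `g_ω (1v) = 1 g_{τω}(v)`. -/
def dirFun (ε : Fin 3 → TreeAut 2) : Omega → List (Fin 2) → List (Fin 2)
  | _, [] => []
  | ω, 0 :: v => 0 :: ε (ω 0) v
  | ω, 1 :: v => 1 :: dirFun ε (shift ω) v

theorem dirFun_inv (ε η : Fin 3 → TreeAut 2) (h : ∀ i, η i * ε i = 1) (v : List (Fin 2)) :
    ∀ ω : Omega, dirFun η ω (dirFun ε ω v) = v := by
  induction v with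
  | nil => intro ω; rfl
  | cons x v ih =>
    intro ω
    fin_cases x
    · change 0 :: (η (ω 0)) (ε (ω 0) v) = 0 :: v
      rw [← RelIso.mul_apply, h]
      rfl
    · change 1 :: dirFun η (shift ω) (dirFun ε (shift ω) v) = 1 :: v
      rw [ih]

theorem treeEdge_dirFun (ε : Fin 3 → TreeAut 2) (u : List (Fin 2)) (y : Fin 2) :
    ∀ ω : Omega, treeEdge 2 (dirFun ε ω u) (dirFun ε ω (u ++ [y])) := by
  induction u with
  | nil =>
    intro ω
    fin_cases y
    · refine ⟨0, ?_⟩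
      change 0 :: ε (ω 0) [] = [0]
      rw [TreeAut.map_nil]
    · exact ⟨1, rfl⟩
  | cons x u ih =>
    intro ω
    fin_cases x
    · obtain ⟨z, hz⟩ := (ε (ω 0)).map_snoc u y
      refine ⟨z, ?_⟩
      change 0 :: ε (ω 0) (u ++ [y]) = 0 :: (ε (ω 0) u ++ [z])
      rw [hz]
    · obtain ⟨z, hz⟩ := ih (shift ω)
      refine ⟨z, ?_⟩
      change 1 :: dirFun ε (shift ω) (u ++ [y]) = 1 :: (dirFun ε (shift ω) u ++ [z])
      rw [hz]

/-- The automorphism given by the recursion `dirFun ε`. -/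
def dirAut (ε : Fin 3 → TreeAut 2) (ω : Omega) : TreeAut 2 where
  toFun := dirFun ε ω
  invFun := dirFun (fun i => (ε i)⁻¹) ω
  left_inv v := dirFun_inv ε _ (fun i => inv_mul_cancel (ε i)) v ω
  right_inv v := dirFun_inv _ ε (fun i => mul_inv_cancel (ε i)) v ω
  map_rel_iff' := by
    intro u v
    constructor
    · rintro ⟨y, hy⟩
      have h2 := treeEdge_dirFun (fun i => (ε i)⁻¹) (dirFun ε ω u) y ω
      change dirFun ε ω v = dirFun ε ω u ++ [y] at hy
      rwa [← hy, dirFun_inv ε _ (fun i => inv_mul_cancel (ε i)),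
        dirFun_inv ε _ (fun i => inv_mul_cancel (ε i))] at h2
    · rintro ⟨y, rfl⟩
      exact treeEdge_dirFun ε u y ω

/-- `β(0) = a`, `β(1) = a`, `β(2) = e`. -/
def beta : Fin 3 → TreeAut 2 := ![a, a, 1]

/-- `ζ(0) = a`, `ζ(1) = e`, `ζ(2) = a`. -/
def zeta : Fin 3 → TreeAut 2 := ![a, 1, a]

/-- `δ(0) = e`, `δ(1) = a`, `δ(2) = a`. -/
def delta : Fin 3 → TreeAut 2 := ![1, a, a]

/-- The automorphism `b_ω`. -/
def b (ω : Omega) : TreeAut 2 := dirAut beta ω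

/-- The automorphism `c_ω`. -/
def c (ω : Omega) : TreeAut 2 := dirAut zeta ω

/-- The automorphism `d_ω`. -/
def d (ω : Omega) : TreeAut 2 := dirAut delta ω

/-- The group `G_ω = ⟨a, b_ω, c_ω, d_ω⟩ ≤ Aut(T_2)`. -/
def G (ω : Omega) : Subgroup (TreeAut 2) := Subgroup.closure {a, b ω, c ω, d ω}

/-! ### The first-level decomposition of `G_ω` -/

theorem rootPerm_a : rootPerm a = Equiv.swap 0 1 := Equiv.ext fun _ => rfl

theorem treeSection_a (x : Fin 2) : treeSection a x = 1 := RelIso.ext fun _ => rfl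

theorem rootPerm_dirAut (ε : Fin 3 → TreeAut 2) (ω : Omega) : rootPerm (dirAut ε ω) = 1 := by
  refine Equiv.ext fun x => ?_
  fin_cases x <;> rfl

theorem treeSection_dirAut_zero (ε : Fin 3 → TreeAut 2) (ω : Omega) :
    treeSection (dirAut ε ω) 0 = ε (ω 0) := RelIso.ext fun _ => rfl

theorem treeSection_dirAut_one (ε : Fin 3 → TreeAut 2) (ω : Omega) :
    treeSection (dirAut ε ω) 1 = dirAut ε (shift ω) := RelIso.ext fun _ => rfl

theorem a_mem (ω : Omega) : a ∈ G ω := Subgroup.subset_closure (by simp)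

theorem b_mem (ω : Omega) : b ω ∈ G ω := Subgroup.subset_closure (by simp)

theorem c_mem (ω : Omega) : c ω ∈ G ω := Subgroup.subset_closure (by simp)

theorem d_mem (ω : Omega) : d ω ∈ G ω := Subgroup.subset_closure (by simp)

theorem treeSection_inv {n : ℕ} (g : TreeAut n) (x : Fin n) :
    treeSection g⁻¹ x = (treeSection g (rootPerm g⁻¹ x))⁻¹ := by
  have h := treeSection_mul g g⁻¹ x
  rw [mul_inv_cancel, treeSection_one] at h
  exact (inv_eq_of_mul_eq_one_right h.symm).symm

/-- The sections at the first level of the elements of `G_ω` lie in `G_{τω}`. -/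
theorem treeSection_mem (ω : Omega) {g : TreeAut 2} (hg : g ∈ G ω) :
    ∀ x : Fin 2, treeSection g x ∈ G (shift ω) := by
  have hdir : ∀ ε : Fin 3 → TreeAut 2, (∀ i, ε i ∈ G (shift ω)) →
      dirAut ε (shift ω) ∈ G (shift ω) →
      ∀ x : Fin 2, treeSection (dirAut ε ω) x ∈ G (shift ω) := by
    intro ε h1 h2 x
    fin_cases x
    · exact (treeSection_dirAut_zero ε ω).symm ▸ h1 (ω 0)
    · exact (treeSection_dirAut_one ε ω).symm ▸ h2
  have ha := a_mem (shift ω)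
  have h1 := one_mem (G (shift ω))
  induction hg using Subgroup.closure_induction with
  | mem g hg =>
    rcases hg with rfl | rfl | rfl | rfl
    · intro x
      rw [treeSection_a]
      exact h1
    · exact hdir beta (by intro i; fin_cases i <;> assumption) (b_mem _)
    · exact hdir zeta (by intro i; fin_cases i <;> assumption) (c_mem _)
    · exact hdir delta (by intro i; fin_cases i <;> assumption) (d_mem _)
  | one =>
    intro x
    rw [treeSection_one]
    exact h1
  | mul g h _ _ ihg ihh =>
    intro x
    rw [treeSection_mul]
    exact mul_mem (ihg _) (ihh _)
  | inv g _ ih =>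
    intro x
    rw [treeSection_inv]
    exact inv_mem (ih _)

/-- The group `S_2 ⋉ (H × H)`, where `S_2` permutes the two factors:
`σ (h_0, h_1) σ⁻¹` has the entry `h_x` at the place `σ(x)`. -/
abbrev Wr (H : Type) [Group H] : Type :=
  (Fin 2 → H) ⋊[(mulAutArrow : Equiv.Perm (Fin 2) →* MulAut (Fin 2 → H))] Equiv.Perm (Fin 2)

/-- The first-level decomposition `φ_ω : G_ω → S_2 ⋉ (G_{τω} × G_{τω})`, `g ↦ σ_g (g_0, g_1)`. -/
def phi (ω : Omega) : G ω →* Wr (G (shift ω)) where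
  toFun g := SemidirectProduct.inr (rootPerm (g : TreeAut 2)) *
    SemidirectProduct.inl fun x => ⟨treeSection (g : TreeAut 2) x, treeSection_mem ω g.2 x⟩
  map_one' := by
    ext x
    · simp [treeSection_one, rootPerm_one]
    · simp [rootPerm_one]
  map_mul' g h := by
    refine SemidirectProduct.ext ?_ ?_
    · funext x
      refine Subtype.ext ?_
      change treeSection ((g : TreeAut 2) * (h : TreeAut 2))
        ((rootPerm ((g : TreeAut 2) * (h : TreeAut 2)))⁻¹ x) = _
      rw [treeSection_mul, rootPerm_mul, mul_inv_rev]
      simp [mulAutArrow_apply_apply]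
      rfl
    · simp [rootPerm_mul]

theorem phi_injective (ω : Omega) : Function.Injective (phi ω) := by
  intro g h hgh
  have h1 : rootPerm (g : TreeAut 2) = rootPerm (h : TreeAut 2) := by
    simpa [phi] using congrArg SemidirectProduct.right hgh
  refine Subtype.ext (treeAut_ext h1 fun x => ?_)
  change (SemidirectProduct.inr (rootPerm (g : TreeAut 2)) * SemidirectProduct.inl _ :
    Wr (G (shift ω))) = SemidirectProduct.inr (rootPerm (h : TreeAut 2)) *
      SemidirectProduct.inl _ at hgh
  rw [h1] at hgh
  exact congrArg Subtype.val
    (congrFun (SemidirectProduct.inl_injective (mul_left_cancel hgh)) x)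

/-- The subgroup `K × K` of `H × H ≤ S_2 ⋉ (H × H)`. -/
def square {H : Type} [Group H] (K : Subgroup H) : Subgroup (Wr H) :=
  (Subgroup.pi Set.univ fun _ : Fin 2 => K).map SemidirectProduct.inl

/-- The third derived subgroup `H'''`. -/
abbrev third (H : Type) [Group H] : Subgroup H := derivedSeries H 3

end GrigBranch

/-!
# First-level decompositions of the groups `G_ω`

Write `H = G_{τω}`. One of the three generators `b_ω`, `c_ω`, `d_ω`, the one whose recursion takes
the value `e` at the first letter of `ω`, has the sections `(1, r)` with `r` the generator of `H` of
the same name. Both projections to `H` of the stabilizer of the first level are onto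
(`sections_top`), so `φ_ω(G_ω)` contains `D × D`, where `D` is the normal closure of `r` in `H`.
Moreover `[(h, 1), (f_0, f_1)] = ([h, f_0], 1)`. Writing `sections K` for the first sections of the
elements of `K ≤ G_ω` fixing the first level, and `rigid 0 K` for the elements `h` with `(h, 1)` in
`φ_ω(K)`, this reads `⁅rigid 0 K, sections L⁆ ≤ rigid 0 ⁅K, L⁆` (`commutator_rigid_sections_le`).

For the third derived subgroups, let `P = sections G_ω'`. It contains `H'`, `r` and `p * a` for each
of the other two recursive generators `p` of `H`. Two applications of the commutator rule put
`⁅⁅D, H⁆, P⁆` into `rigid 0 G_ω''`. As `H` is generated by `a`, `p` and `r`, its derived subgroup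
lies in `⟨p * a⟩ ⁅D, H⁆`, which is abelian modulo `⁅⁅D, H⁆, P⁆`; hence `H'' ≤ rigid 0 G_ω''`
(`derivedSeries_two_le_rigid`), and one more commutator gives `H''' ≤ rigid 0 G_ω'''`.

For the branch property it is enough that `rigid 0 K` has finite index in `H` for each normal
subgroup `K` of finite index in `G_ω` (`finiteIndex_rigid`): induction on the level over all such `K`
then gives the finite index of the rigid level stabilizers (`finiteIndex_ristLevelIn`). The
commutator rule shows `⁅D, S⁆ ≤ rigid 0 K` for `S = sections K`, which is normal of finite index in
`H`. The quotient `H / D` is generated by the images of the involutions `a` and `p`, whose product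
has finite order because the letter of `p` occurs in `τω` (`exists_pow_a_mul_gen_eq_one`), so `D` has
finite index. Modulo `⁅D, S⁆`, the centre of `D` has finite index in `D`, so by Schur's theorem `D`
has finite derived subgroup; being finitely generated, and generated by involutions, `D` is finite
modulo `⁅D, S⁆` (`finiteIndex_commutator_normalClosure`).
-/

namespace GrigBranch

/-! ### Commutators and finiteness in groups -/

section Abstract

open Subgroup
open scoped commutatorElement

variable {H : Type*} [Group H]

theorem commutator_le_of_closure {S : Set H} (hS : closure S = ⊤) (X : Subgroup H) [X.Normal]
    (h : ∀ s ∈ S, ∀ t ∈ S, ⁅s, t⁆ ∈ X) : ⁅(⊤ : Subgroup H), (⊤ : Subgroup H)⁆ ≤ X := by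
  have hcomm : IsMulCommutative (closure (QuotientGroup.mk' X '' S)) := by
    refine isMulCommutative_closure ?_
    rintro _ ⟨s, hs, rfl⟩ _ ⟨t, ht, rfl⟩
    rw [← commutatorElement_eq_one_iff_mul_comm, ← map_commutatorElement]
    exact (QuotientGroup.eq_one_iff _).2 (h s hs t ht)
  have hmem : ∀ g : H, QuotientGroup.mk' X g ∈ closure (QuotientGroup.mk' X '' S) := by
    intro g
    rw [← MonoidHom.map_closure, hS]
    exact mem_map_of_mem _ (mem_top g)
  refine commutator_le.2 fun g _ k _ => ?_
  rw [← QuotientGroup.eq_one_iff]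
  change QuotientGroup.mk' X ⁅g, k⁆ = 1
  rw [map_commutatorElement, commutatorElement_eq_one_iff_mul_comm]
  exact setLike_mul_comm (hmem g) (hmem k)

theorem normal_of_closure_involutions {S : Set H} (hS : closure S = ⊤) (hinv : ∀ s ∈ S, s * s = 1)
    (X : Subgroup H) (h : ∀ s ∈ S, ∀ x ∈ X, s * x * s⁻¹ ∈ X) : X.Normal := by
  rw [← normalizer_eq_top_iff, eq_top_iff, ← hS, closure_le]
  intro s hs
  refine mem_normalizer_iff.2 fun x => ⟨h s hs x, fun hx => ?_⟩
  have h1 := h s hs _ hx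
  have h2 : s⁻¹ = s := inv_eq_of_mul_eq_one_left (hinv s hs)
  have h3 : s * (s * x * s⁻¹) * s⁻¹ = (s * s) * x * (s * s) := by rw [h2]; group
  rwa [h3, hinv s hs, one_mul, mul_one] at h1

/-- If `H` is generated by involutions `a`, `p`, `r` such that `r` is central modulo `E`, then
`H` modulo `E` is a central product of a dihedral group and a cyclic group, in which the subgroup
of rotations is normal and contains all commutators. -/
theorem normal_and_commutator_le_zpowers_sup {a p r : H} (hS : closure {a, p, r} = ⊤)
    (ha : a * a = 1) (hp : p * p = 1) (hr : r * r = 1) (E : Subgroup H) [hE : E.Normal]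
    (hra : ⁅r, a⁆ ∈ E) (hrp : ⁅r, p⁆ ∈ E) :
    (zpowers (p * a) ⊔ E).Normal ∧
      ⁅(⊤ : Subgroup H), (⊤ : Subgroup H)⁆ ≤ zpowers (p * a) ⊔ E := by
  have ha' : a⁻¹ = a := inv_eq_of_mul_eq_one_left ha
  have hp' : p⁻¹ = p := inv_eq_of_mul_eq_one_left hp
  have hz : p * a ∈ zpowers (p * a) ⊔ E := mem_sup_left (mem_zpowers _)
  have hN : (zpowers (p * a) ⊔ E).Normal := by
    refine normal_of_closure_involutions hS ?_ _ ?_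
    · rintro s (rfl | rfl | rfl) <;> assumption
    · intro s hs x hx
      obtain ⟨y, hy, e, he, rfl⟩ := mem_sup_of_normal_right.1 hx
      obtain ⟨n, rfl⟩ := mem_zpowers_iff.1 hy
      have hconj : s * (p * a) * s⁻¹ ∈ zpowers (p * a) ⊔ E := by
        rcases hs with rfl | rfl | rfl
        · have h1 : s * (p * s) * s⁻¹ = (p * s)⁻¹ := by
            rw [mul_inv_rev, hp', ha', mul_assoc, mul_assoc, ha, mul_one]
          rw [h1]
          exact inv_mem hz
        · have h1 : s * (s * a) * s⁻¹ = (s * a)⁻¹ := by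
            rw [mul_inv_rev, hp', ha', ← mul_assoc, hp, one_mul]
          rw [h1]
          exact inv_mem hz
        · have h1 : s * (p * a) * s⁻¹ = (⁅s, p⁆ * (p * ⁅s, a⁆ * p⁻¹)) * (p * a) := by
            simp only [commutatorElement_def]
            group
          rw [h1]
          exact mul_mem (mem_sup_right (mul_mem hrp (hE.conj_mem _ hra _))) hz
      have h2 : s * ((p * a) ^ n * e) * s⁻¹ = (s * (p * a) * s⁻¹) ^ n * (s * e * s⁻¹) := by
        rw [conj_zpow]
        group
      rw [h2]
      exact mul_mem (zpow_mem hconj n) (mem_sup_right (hE.conj_mem _ he _))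
  refine ⟨hN, commutator_le_of_closure hS _ ?_⟩
  have hpa : ⁅p, a⁆ ∈ zpowers (p * a) ⊔ E := by
    rw [commutatorElement_def, hp', ha', mul_assoc]
    exact mul_mem hz hz
  have hsymm : ∀ {s t : H}, ⁅s, t⁆ ∈ zpowers (p * a) ⊔ E → ⁅t, s⁆ ∈ zpowers (p * a) ⊔ E := by
    intro s t h
    rw [← commutatorElement_inv]
    exact inv_mem h
  have hra' := mem_sup_right (S := zpowers (p * a)) hra
  have hrp' := mem_sup_right (S := zpowers (p * a)) hrp
  rintro s (rfl | rfl | rfl) t (rfl | rfl | rfl) <;>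
    first
    | (rw [commutatorElement_self]; exact one_mem _)
    | assumption
    | (apply hsymm; assumption)

/-- The algebraic core of the inclusion of third derived subgroups: for `D` and `P` normal with
`D ≤ P`, the subgroup `⁅⁅D, H⁆, P⁆` contains `H''` as soon as `r ∈ D` and `p * a ∈ P`, because `H'`
is contained in the product of `⁅D, H⁆` and the cyclic group generated by `p * a`, and this product
is abelian modulo `⁅⁅D, H⁆, P⁆`. -/
theorem commutator_commutator_le {a p r : H} (hS : closure {a, p, r} = ⊤)
    (ha : a * a = 1) (hp : p * p = 1) (hr : r * r = 1) (D P : Subgroup H) [D.Normal] [P.Normal]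
    (hDP : D ≤ P) (hrD : r ∈ D) (hpa : p * a ∈ P) :
    ⁅⁅(⊤ : Subgroup H), (⊤ : Subgroup H)⁆, ⁅(⊤ : Subgroup H), (⊤ : Subgroup H)⁆⁆ ≤
      ⁅⁅D, (⊤ : Subgroup H)⁆, P⁆ := by
  obtain ⟨-, hX⟩ := normal_and_commutator_le_zpowers_sup hS ha hp hr ⁅D, (⊤ : Subgroup H)⁆
    (commutator_mem_commutator hrD (mem_top _)) (commutator_mem_commutator hrD (mem_top _))
  refine (commutator_mono hX hX).trans ?_
  rw [sup_eq_closure]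
  have hEP : ⁅D, (⊤ : Subgroup H)⁆ ≤ P := (commutator_le_left D ⊤).trans hDP
  set N := ⁅⁅D, (⊤ : Subgroup H)⁆, P⁆ with hN
  have key : IsMulCommutative ((closure ((zpowers (p * a) : Set H) ∪
      (⁅D, (⊤ : Subgroup H)⁆ : Subgroup H))).map (QuotientGroup.mk' N)) := by
    rw [MonoidHom.map_closure]
    refine isMulCommutative_closure ?_
    have hc : ∀ e ∈ ⁅D, (⊤ : Subgroup H)⁆, ∀ x ∈ P,
        QuotientGroup.mk' N e * QuotientGroup.mk' N x =
          QuotientGroup.mk' N x * QuotientGroup.mk' N e := by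
      intro e he x hx
      rw [← commutatorElement_eq_one_iff_mul_comm, ← map_commutatorElement]
      exact (QuotientGroup.eq_one_iff _).2 (commutator_mem_commutator he hx)
    have hz : zpowers (p * a) ≤ P := zpowers_le.2 hpa
    rintro _ ⟨s, hs | hs, rfl⟩ _ ⟨t, ht | ht, rfl⟩
    · rw [← map_mul, ← map_mul]
      exact congrArg _ (setLike_mul_comm hs ht)
    · exact (hc t ht s (hz hs)).symm
    · exact hc s hs t (hz ht)
    · exact hc s hs t (hEP ht)
  refine commutator_le.2 fun g hg k hk => ?_
  rw [← QuotientGroup.eq_one_iff]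
  change QuotientGroup.mk' N ⁅g, k⁆ = 1
  rw [map_commutatorElement, commutatorElement_eq_one_iff_mul_comm]
  exact setLike_mul_comm (mem_map_of_mem _ hg) (mem_map_of_mem _ hk)

/-- A finitely generated group with finite derived subgroup which is generated by elements of
finite order is finite: its abelianization is a finitely generated abelian torsion group. -/
theorem finite_of_finite_commutator [Group.FG H] {S : Set H} (hS : closure S = ⊤)
    (hfin : ∀ s ∈ S, IsOfFinOrder s) [Finite (_root_.commutator H)] : Finite H := by
  have htors : IsMulTorsion (Abelianization H) := by
    have h : ∀ g : H, IsOfFinOrder (Abelianization.of g) := by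
      intro g
      have hg : g ∈ closure S := hS ▸ mem_top g
      induction hg using closure_induction with
      | mem s hs => exact MonoidHom.isOfFinOrder _ (hfin s hs)
      | one => rw [map_one]; exact IsOfFinOrder.one
      | mul x y _ _ hx hy => rw [map_mul]; exact hx.mul hy
      | inv x _ hx => rw [map_inv]; exact hx.inv
    intro q
    obtain ⟨g, rfl⟩ := QuotientGroup.mk_surjective q
    exact h g
  have : Group.FG (Abelianization H) := Group.fg_of_surjective (f := Abelianization.of)
    QuotientGroup.mk_surjective
  have : Finite (H ⧸ _root_.commutator H) :=
    CommGroup.finite_of_fg_isMulTorsion (G := Abelianization H) htors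
  exact (finite_iff_finite_and_finiteIndex _).2
    ⟨inferInstance, finiteIndex_iff_finite_quotient.2 this⟩

theorem finite_commutatorSet_of_finiteIndex_center [(center H).FiniteIndex] :
    Finite (commutatorSet H) := by
  refine Set.Finite.subset (Set.finite_range
    fun q : (H ⧸ center H) × (H ⧸ center H) => ⁅q.1.out, q.2.out⁆) ?_
  rintro _ ⟨g, k, rfl⟩
  refine ⟨(g, k), ?_⟩
  obtain ⟨y, hy⟩ := QuotientGroup.mk_out_eq_mul (center H) g
  obtain ⟨z, hz⟩ := QuotientGroup.mk_out_eq_mul (center H) k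
  have hyc : ∀ x : H, (y : H) * x = x * y := fun x => (mem_center_iff.1 y.2 x).symm
  have hzc : ∀ x : H, (z : H) * x = x * z := fun x => (mem_center_iff.1 z.2 x).symm
  dsimp only
  rw [hy, hz, commutatorElement_def, commutatorElement_def, mul_inv_rev, mul_inv_rev]
  calc g * y * (k * z) * ((y : H)⁻¹ * g⁻¹) * ((z : H)⁻¹ * k⁻¹)
      = g * (y * (k * z)) * (y : H)⁻¹ * g⁻¹ * (z : H)⁻¹ * k⁻¹ := by group
    _ = g * k * (z * g⁻¹) * (z : H)⁻¹ * k⁻¹ := by rw [hyc]; group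
    _ = g * k * g⁻¹ * k⁻¹ := by rw [hzc]; group

/-- If a subgroup `S` of finite index centralizes the normal closure `D` of `r`, then the centre of
`D` has finite index, so `D` has finite derived subgroup by Schur's theorem, and `D` is generated
by conjugates of `r`. -/
theorem finite_of_commutator_normalClosure_eq_bot [Group.FG H] {r : H} (hr : IsOfFinOrder r)
    (S : Subgroup H) [S.FiniteIndex] [(normalClosure {r}).FiniteIndex]
    (h : ⁅normalClosure {r}, S⁆ = ⊥) : Finite H := by
  have hle : S.subgroupOf (normalClosure {r}) ≤ center (normalClosure {r}) := by
    intro s hs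
    refine mem_center_iff.2 fun x => Subtype.ext ?_
    rw [commutator_eq_bot_iff_le_centralizer] at h
    exact (mem_centralizer_iff.1 (h x.2) s (mem_subgroupOf.1 hs)).symm
  have : (center (normalClosure {r})).FiniteIndex := finiteIndex_of_le hle
  have : Finite (commutatorSet (normalClosure {r})) := finite_commutatorSet_of_finiteIndex_center
  have : Group.FG (normalClosure {r}) := fg_of_index_ne_zero _
  have : Finite (normalClosure {r}) := by
    have hcl : closure (((↑) : normalClosure {r} → H) ⁻¹' Group.conjugatesOfSet {r}) = ⊤ :=
      closure_closure_coe_preimage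
    refine finite_of_finite_commutator hcl ?_
    rintro ⟨x, hx⟩ hs
    obtain ⟨y, hy, hc⟩ := Group.mem_conjugatesOfSet_iff.1 hs
    obtain rfl : y = r := hy
    obtain ⟨g, rfl⟩ := isConj_iff.1 hc
    rw [← Submonoid.isOfFinOrder_coe]
    exact (MulAut.conj g).toMonoidHom.isOfFinOrder hr
  exact (finite_iff_finite_and_finiteIndex _).2 ⟨this, inferInstance⟩

theorem finiteIndex_map_of_surjective {K : Type*} [Group K] {f : H →* K}
    (hf : Function.Surjective f) (S : Subgroup H) [S.FiniteIndex] : (S.map f).FiniteIndex :=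
  ⟨ne_zero_of_dvd_ne_zero FiniteIndex.index_ne_zero (index_map_dvd S hf)⟩

theorem finiteIndex_commutator_normalClosure [Group.FG H] {r : H} (hr : IsOfFinOrder r)
    (S : Subgroup H) [S.Normal] [S.FiniteIndex] [(normalClosure {r}).FiniteIndex] :
    ⁅normalClosure {r}, S⁆.FiniteIndex := by
  set N := ⁅normalClosure {r}, S⁆ with hN
  have hs : Function.Surjective (QuotientGroup.mk' N) := QuotientGroup.mk'_surjective N
  have hD : (normalClosure {r}).map (QuotientGroup.mk' N) =
      normalClosure {QuotientGroup.mk' N r} := by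
    rw [map_normalClosure _ _ hs, Set.image_singleton]
  have : (normalClosure {QuotientGroup.mk' N r}).FiniteIndex :=
    hD ▸ finiteIndex_map_of_surjective hs _
  have : (S.map (QuotientGroup.mk' N)).FiniteIndex := finiteIndex_map_of_surjective hs _
  have : Finite (H ⧸ N) := by
    refine finite_of_commutator_normalClosure_eq_bot (MonoidHom.isOfFinOrder (QuotientGroup.mk' N) hr)
      (S.map (QuotientGroup.mk' N)) ?_
    rw [← hD, ← map_commutator, ← hN, Subgroup.map_eq_bot_iff, QuotientGroup.ker_mk']
  exact finiteIndex_iff_finite_quotient.2 this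

/-- The quotient by the normal closure of `r` is dihedral, and finite because `p * a` has finite
order. -/
theorem finiteIndex_normalClosure_of_involutions {a p r : H} (hS : closure {a, p, r} = ⊤)
    (ha : a * a = 1) (hp : p * p = 1) (hr : r * r = 1) (hpa : IsOfFinOrder (p * a)) :
    (normalClosure {r}).FiniteIndex := by
  set D := normalClosure {r} with hD
  have hrD : r ∈ D := subset_normalClosure rfl
  have hrc : ∀ x, ⁅r, x⁆ ∈ D := fun x =>
    commutator_le_left D ⊤ (commutator_mem_commutator hrD (mem_top x))
  obtain ⟨-, hX⟩ := normal_and_commutator_le_zpowers_sup hS ha hp hr D (hrc a) (hrc p)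
  have hs : Function.Surjective (QuotientGroup.mk' D) := QuotientGroup.mk'_surjective D
  have hcl : closure (QuotientGroup.mk' D '' {a, p, r}) = ⊤ := by
    rw [← MonoidHom.map_closure, hS, map_top_of_surjective _ hs]
  have : Group.FG (H ⧸ D) :=
    Group.fg_iff.2 ⟨_, hcl, (Set.toFinite {a, p, r}).image _⟩
  have hle : _root_.commutator (H ⧸ D) ≤ zpowers (QuotientGroup.mk' D (p * a)) := by
    have h1 : _root_.commutator (H ⧸ D) =
        ⁅(⊤ : Subgroup H), (⊤ : Subgroup H)⁆.map (QuotientGroup.mk' D) := by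
      rw [map_commutator, map_top_of_surjective _ hs, _root_.commutator_def]
    rw [h1]
    refine (map_mono hX).trans ?_
    rw [Subgroup.map_sup, MonoidHom.map_zpowers, QuotientGroup.map_mk'_self, sup_bot_eq]
  have : Finite (zpowers (QuotientGroup.mk' D (p * a))) :=
    finite_zpowers.2 (MonoidHom.isOfFinOrder _ hpa)
  have : Finite (_root_.commutator (H ⧸ D)) := Finite.Set.subset _ hle
  have hinv : ∀ s : H, s * s = 1 → IsOfFinOrder s := fun s h =>
    isOfFinOrder_iff_pow_eq_one.2 ⟨2, two_pos, by rw [pow_two, h]⟩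
  have : Finite (H ⧸ D) := by
    refine finite_of_finite_commutator hcl ?_
    rintro _ ⟨s, hs, rfl⟩
    refine MonoidHom.isOfFinOrder _ (hinv s ?_)
    rcases hs with rfl | rfl | rfl <;> assumption
  exact finiteIndex_iff_finite_quotient.2 this

end Abstract

/-! ### The generators of `G_ω` -/

/-- The values of the recursions: `offLetter i` is `e` at the letter `i` and `a` at the other two
letters. -/
def offLetter (i j : Fin 3) : TreeAut 2 := if j = i then 1 else a

/-- The three recursively defined generators, indexed by the letter at which the recursion takes the
value `e`: `gen 0 = d`, `gen 1 = c` and `gen 2 = b`. -/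
def gen (i : Fin 3) (ω : Omega) : TreeAut 2 := dirAut (offLetter i) ω

theorem gen_zero (ω : Omega) : gen 0 ω = d ω := by
  have h : offLetter 0 = delta := by funext j; fin_cases j <;> rfl
  rw [gen, h, d]

theorem gen_one (ω : Omega) : gen 1 ω = c ω := by
  have h : offLetter 1 = zeta := by funext j; fin_cases j <;> rfl
  rw [gen, h, c]

theorem gen_two (ω : Omega) : gen 2 ω = b ω := by
  have h : offLetter 2 = beta := by funext j; fin_cases j <;> rfl
  rw [gen, h, b]

theorem gen_mem (i : Fin 3) (ω : Omega) : gen i ω ∈ G ω := by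
  fin_cases i
  · exact gen_zero ω ▸ d_mem ω
  · exact gen_one ω ▸ c_mem ω
  · exact gen_two ω ▸ b_mem ω

theorem a_mul_a : a * a = 1 := RelIso.ext aFun_aFun

theorem dirAut_mul (ε η : Fin 3 → TreeAut 2) (ω : Omega) :
    dirAut ε ω * dirAut η ω = dirAut (fun i => ε i * η i) ω := by
  refine RelIso.ext fun v => ?_
  change dirFun ε ω (dirFun η ω v) = dirFun (fun i => ε i * η i) ω v
  induction v generalizing ω with
  | nil => rfl
  | cons x v ih =>
    fin_cases x
    · rfl
    · exact congrArg (List.cons 1) (ih (shift ω))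

theorem dirAut_one (ω : Omega) : dirAut (fun _ => 1) ω = 1 := by
  refine RelIso.ext fun v => ?_
  change dirFun (fun _ => 1) ω v = v
  induction v generalizing ω with
  | nil => rfl
  | cons x v ih =>
    fin_cases x
    · rfl
    · exact congrArg (List.cons 1) (ih (shift ω))

theorem offLetter_mul_self (i j : Fin 3) : offLetter i j * offLetter i j = 1 := by
  unfold offLetter
  split_ifs
  · rw [one_mul]
  · exact a_mul_a

theorem gen_mul_self (i : Fin 3) (ω : Omega) : gen i ω * gen i ω = 1 := by
  rw [gen, dirAut_mul, funext (offLetter_mul_self i), dirAut_one]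

/-- `b_ω`, `c_ω`, `d_ω` and the identity form a Klein four-group. -/
theorem gen_mul_gen {i j k : Fin 3} (hij : i ≠ j) (hik : i ≠ k) (hjk : j ≠ k) (ω : Omega) :
    gen i ω * gen j ω = gen k ω := by
  have h : (fun l => offLetter i l * offLetter j l) = offLetter k := by
    funext l
    simp only [offLetter]
    by_cases h1 : l = i
    · subst h1
      simp [hij, hik]
    · by_cases h2 : l = j
      · subst h2
        simp [h1, hjk]
      · have h3 : l = k := by omega
        subst h3
        simp [hik.symm, hjk.symm, a_mul_a]
  rw [gen, gen, dirAut_mul, h, gen]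

theorem rootPerm_gen (i : Fin 3) (ω : Omega) : rootPerm (gen i ω) = 1 := rootPerm_dirAut _ _

theorem treeSection_gen_zero (i : Fin 3) (ω : Omega) :
    treeSection (gen i ω) 0 = offLetter i (ω 0) := treeSection_dirAut_zero _ _

theorem treeSection_gen_one (i : Fin 3) (ω : Omega) :
    treeSection (gen i ω) 1 = gen i (shift ω) := treeSection_dirAut_one _ _

theorem G_eq_closure {i j : Fin 3} (hij : i ≠ j) (ω : Omega) :
    G ω = Subgroup.closure {a, gen i ω, gen j ω} := by
  have hsub : ∀ k, gen k ω ∈ Subgroup.closure {a, gen i ω, gen j ω} := by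
    intro k
    have hi : gen i ω ∈ Subgroup.closure {a, gen i ω, gen j ω} :=
      Subgroup.subset_closure (by simp)
    have hj : gen j ω ∈ Subgroup.closure {a, gen i ω, gen j ω} :=
      Subgroup.subset_closure (by simp)
    by_cases h1 : i = k
    · exact h1 ▸ hi
    · by_cases h2 : j = k
      · exact h2 ▸ hj
      · rw [← gen_mul_gen hij h1 h2]
        exact mul_mem hi hj
  refine le_antisymm ?_ ?_ <;> rw [G, Subgroup.closure_le]
  · rintro g (rfl | rfl | rfl | rfl)
    · exact Subgroup.subset_closure (by simp)
    · exact gen_two ω ▸ hsub 2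
    · exact gen_one ω ▸ hsub 1
    · exact gen_zero ω ▸ hsub 0
  · rintro g (rfl | rfl | rfl)
    · exact a_mem ω
    · exact gen_mem i ω
    · exact gen_mem j ω

/-- `a` as an element of `G_ω`. -/
def aG (ω : Omega) : G ω := ⟨a, a_mem ω⟩

/-- `gen i ω` as an element of `G_ω`. -/
def genG (i : Fin 3) (ω : Omega) : G ω := ⟨gen i ω, gen_mem i ω⟩

theorem closure_aG_genG {i j : Fin 3} (hij : i ≠ j) (ω : Omega) :
    Subgroup.closure {aG ω, genG i ω, genG j ω} = ⊤ := by
  refine Subgroup.map_injective (G ω).subtype_injective ?_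
  have h : (G ω).subtype '' {aG ω, genG i ω, genG j ω} = {a, gen i ω, gen j ω} := by
    simp [Set.image_insert_eq, aG, genG]
  rw [MonoidHom.map_closure, ← MonoidHom.range_eq_map, Subgroup.range_subtype, h,
    ← G_eq_closure hij]

theorem aG_mul_self (ω : Omega) : aG ω * aG ω = 1 := Subtype.ext a_mul_a

theorem genG_mul_self (i : Fin 3) (ω : Omega) : genG i ω * genG i ω = 1 :=
  Subtype.ext (gen_mul_self i ω)

instance (ω : Omega) : Group.FG (G ω) :=
  Group.fg_iff.2 ⟨_, closure_aG_genG zero_ne_one ω, Set.toFinite _⟩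

/-- The element `a * gen i ω` has finite order if the letter `i` occurs in `ω`: its square has the
sections `g' * a` and `a * g'` with `g' = gen i (shift ω)` unless `ω` starts with `i`, and then its
square is the involution with both sections equal to `g'`. -/
theorem exists_pow_a_mul_gen_eq_one (i : Fin 3) (n : ℕ) :
    ∀ ω : Omega, ω n = i → ∃ k, 0 < k ∧ (a * gen i ω) ^ k = 1 := by
  have hroot : ∀ ω, rootPerm ((a * gen i ω) ^ 2) = 1 := by
    intro ω
    rw [pow_two, rootPerm_mul, rootPerm_mul, rootPerm_a, rootPerm_gen, mul_one,
      Equiv.swap_mul_self]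
  have hsec : ∀ ω x, treeSection ((a * gen i ω) ^ 2) x =
      treeSection (gen i ω) (Equiv.swap 0 1 x) * treeSection (gen i ω) x := by
    intro ω x
    simp only [pow_two, treeSection_mul, rootPerm_mul, rootPerm_a, rootPerm_gen, treeSection_a,
      mul_one, one_mul, Equiv.Perm.one_apply]
  have hpow : ∀ (g : TreeAut 2), rootPerm g = 1 → ∀ (x : Fin 2) (k : ℕ),
      rootPerm (g ^ k) = 1 ∧ treeSection (g ^ k) x = treeSection g x ^ k := by
    intro g hg x k
    induction k with
    | zero => simp [rootPerm_one, treeSection_one]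
    | succ k ih =>
      rw [pow_succ, pow_succ, rootPerm_mul, treeSection_mul, hg, ih.1]
      exact ⟨mul_one 1, by rw [Equiv.Perm.one_apply, ih.2]⟩
  have step : ∀ (ω : Omega) (k : ℕ), 0 < k →
      (∀ x, treeSection ((a * gen i ω) ^ 2) x ^ k = 1) →
      ∃ k, 0 < k ∧ (a * gen i ω) ^ k = 1 := by
    intro ω k hk h
    refine ⟨2 * k, by omega, ?_⟩
    rw [pow_mul]
    refine treeAut_ext ?_ fun x => ?_
    · rw [(hpow _ (hroot ω) 0 k).1, rootPerm_one]
    · rw [(hpow _ (hroot ω) x k).2, h, treeSection_one]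
  have hbase : ∀ ω : Omega, ω 0 = i → ∃ k, 0 < k ∧ (a * gen i ω) ^ k = 1 := by
    intro ω h
    refine step ω 2 two_pos fun x => ?_
    rw [hsec]
    fin_cases x
    · simp [treeSection_gen_zero, treeSection_gen_one, offLetter, h, pow_two, gen_mul_self]
    · simp [treeSection_gen_zero, treeSection_gen_one, offLetter, h, pow_two, gen_mul_self]
  induction n with
  | zero => exact hbase
  | succ n ih =>
    intro ω hω
    by_cases h0 : ω 0 = i
    · exact hbase ω h0
    · obtain ⟨k, hk, h⟩ := ih (shift ω) hω
      refine step ω k hk fun x => ?_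
      rw [hsec]
      fin_cases x
      · have h2 : gen i (shift ω) * a = a⁻¹ * (a * gen i (shift ω)) * a⁻¹⁻¹ := by group
        simp only [Fin.zero_eta, Equiv.swap_apply_left, treeSection_gen_zero, treeSection_gen_one,
          offLetter, h0, if_false]
        rw [h2, conj_pow, h, mul_one, mul_inv_cancel]
      · simpa [treeSection_gen_zero, treeSection_gen_one, offLetter, h0] using h

theorem isOfFinOrder_genG_mul_aG {i : Fin 3} {n : ℕ} {ω : Omega} (h : ω n = i) :
    IsOfFinOrder (genG i ω * aG ω) := by
  obtain ⟨k, hk, h⟩ := exists_pow_a_mul_gen_eq_one i n ω h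
  refine isOfFinOrder_iff_pow_eq_one.2 ⟨k, hk, Subtype.ext ?_⟩
  have h2 : gen i ω * a = a⁻¹ * (a * gen i ω) * a⁻¹⁻¹ := by group
  change (gen i ω * a) ^ k = 1
  rw [h2, conj_pow, h, mul_one, mul_inv_cancel]

/-! ### First-level decompositions of subgroups -/

section FirstLevel

open Subgroup
open scoped commutatorElement

variable {ω : Omega}

theorem phi_eq_inl {g : G ω} {f : Fin 2 → G (shift ω)} :
    phi ω g = SemidirectProduct.inl f ↔
      rootPerm (g : TreeAut 2) = 1 ∧ ∀ x, treeSection (g : TreeAut 2) x = f x := by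
  constructor
  · intro h
    have h1 : rootPerm (g : TreeAut 2) = 1 := by
      simpa [phi] using congrArg SemidirectProduct.right h
    refine ⟨h1, fun x => ?_⟩
    change (SemidirectProduct.inr (rootPerm (g : TreeAut 2)) * SemidirectProduct.inl _ :
      Wr (G (shift ω))) = _ at h
    rw [h1, map_one, one_mul] at h
    exact congrArg Subtype.val (congrFun (SemidirectProduct.inl_injective h) x)
  · rintro ⟨h1, h2⟩
    change (SemidirectProduct.inr (rootPerm (g : TreeAut 2)) * SemidirectProduct.inl _ :
      Wr (G (shift ω))) = _
    rw [h1, map_one, one_mul]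
    exact congrArg SemidirectProduct.inl (funext fun x => Subtype.ext (h2 x))

/-- The pairs of sections `(g_0, g_1)` of the elements `g` of `K` which fix the first level. -/
def firstLevel (K : Subgroup (G ω)) : Subgroup (Fin 2 → G (shift ω)) :=
  (K.map (phi ω)).comap SemidirectProduct.inl

theorem mem_firstLevel {K : Subgroup (G ω)} {f : Fin 2 → G (shift ω)} :
    f ∈ firstLevel K ↔ ∃ g ∈ K, rootPerm (g : TreeAut 2) = 1 ∧
      ∀ x, treeSection (g : TreeAut 2) x = f x := by
  simp only [firstLevel, mem_comap, mem_map, phi_eq_inl]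

theorem firstLevel_mono {K L : Subgroup (G ω)} (h : K ≤ L) : firstLevel K ≤ firstLevel L :=
  comap_mono (map_mono h)

theorem commutator_firstLevel_le (K L : Subgroup (G ω)) :
    ⁅firstLevel K, firstLevel L⁆ ≤ firstLevel ⁅K, L⁆ := by
  refine commutator_le.2 fun f hf f' hf' => ?_
  change SemidirectProduct.inl ⁅f, f'⁆ ∈ ⁅K, L⁆.map (phi ω)
  rw [map_commutatorElement, map_commutator]
  exact commutator_mem_commutator hf hf'

/-- The first sections `g_0` of the elements `g` of `K` which fix the first level. -/
def sections (K : Subgroup (G ω)) : Subgroup (G (shift ω)) :=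
  (firstLevel K).map (Pi.evalMonoidHom _ 0)

/-- The elements `h` for which `K` contains the automorphism that fixes the first level and has the
section `h` at `x` and the trivial section at the other vertex. -/
def rigid (x : Fin 2) (K : Subgroup (G ω)) : Subgroup (G (shift ω)) :=
  (firstLevel K).comap (MonoidHom.mulSingle (fun _ => G (shift ω)) x)

theorem mem_sections {K : Subgroup (G ω)} {h : G (shift ω)} :
    h ∈ sections K ↔ ∃ g ∈ K, rootPerm (g : TreeAut 2) = 1 ∧ treeSection (g : TreeAut 2) 0 = h := by
  constructor
  · rintro ⟨f, hf, rfl⟩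
    obtain ⟨g, hg, h1, h2⟩ := mem_firstLevel.1 hf
    exact ⟨g, hg, h1, h2 0⟩
  · rintro ⟨g, hg, h1, h2⟩
    exact ⟨fun x => ⟨_, treeSection_mem ω g.2 x⟩, mem_firstLevel.2 ⟨g, hg, h1, fun _ => rfl⟩,
      Subtype.ext h2⟩

theorem mem_rigid {x : Fin 2} {K : Subgroup (G ω)} {h : G (shift ω)} :
    h ∈ rigid x K ↔ ∃ g ∈ K, rootPerm (g : TreeAut 2) = 1 ∧
      ∀ y, treeSection (g : TreeAut 2) y = (Pi.mulSingle x h : Fin 2 → G (shift ω)) y := mem_firstLevel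

theorem rigid_mono (x : Fin 2) {K L : Subgroup (G ω)} (h : K ≤ L) : rigid x K ≤ rigid x L :=
  comap_mono (firstLevel_mono h)

theorem sections_mono {K L : Subgroup (G ω)} (h : K ≤ L) : sections K ≤ sections L :=
  map_mono (firstLevel_mono h)

theorem commutator_sections_le (K L : Subgroup (G ω)) :
    ⁅sections K, sections L⁆ ≤ sections ⁅K, L⁆ := by
  rw [sections, sections, ← map_commutator]
  exact map_mono (commutator_firstLevel_le K L)

/-- The commutator of `(h, 1)` and `(f_0, f_1)` is `([h, f_0], 1)`. -/
theorem commutator_rigid_sections_le (K L : Subgroup (G ω)) :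
    ⁅rigid 0 K, sections L⁆ ≤ rigid 0 ⁅K, L⁆ := by
  refine commutator_le.2 ?_
  rintro h hh _ ⟨f, hf, rfl⟩
  have h1 : ⁅(Pi.mulSingle 0 h : Fin 2 → G (shift ω)), f⁆ = Pi.mulSingle 0 ⁅h, f 0⁆ := by
    funext x
    fin_cases x <;> simp [commutatorElement_def]
  change (Pi.mulSingle 0 ⁅h, f 0⁆ : Fin 2 → G (shift ω)) ∈ firstLevel ⁅K, L⁆
  rw [← h1]
  exact commutator_firstLevel_le K L (commutator_mem_commutator hh hf)

theorem a_mul_mul_a_sections (g : TreeAut 2) (hg : rootPerm g = 1) :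
    rootPerm (a * g * a⁻¹) = 1 ∧
      ∀ x, treeSection (a * g * a⁻¹) x = treeSection g (Equiv.swap 0 1 x) := by
  have ha : a⁻¹ = a := inv_eq_of_mul_eq_one_left a_mul_a
  rw [ha]
  constructor
  · rw [rootPerm_mul, rootPerm_mul, rootPerm_a, hg, mul_one, Equiv.swap_mul_self]
  · intro x
    simp only [treeSection_mul, treeSection_a, rootPerm_a, mul_one, one_mul]

/-- The pair of sections is subdirect: both projections of the stabilizer of the first level are
onto. -/
theorem sections_top : sections (⊤ : Subgroup (G ω)) = ⊤ := by
  have hgen : ∀ i, genG i (shift ω) ∈ sections (⊤ : Subgroup (G ω)) := by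
    intro i
    obtain ⟨h1, h2⟩ := a_mul_mul_a_sections (gen i ω) (rootPerm_gen i ω)
    exact mem_sections.2 ⟨aG ω * genG i ω * (aG ω)⁻¹, mem_top _, h1, (h2 0).trans (by
      rw [Equiv.swap_apply_left, treeSection_gen_one]; rfl)⟩
  obtain ⟨j, hj⟩ := exists_ne (ω 0)
  rw [eq_top_iff, ← closure_aG_genG hj (shift ω), closure_le]
  rintro _ (rfl | rfl | rfl)
  · refine mem_sections.2 ⟨genG j ω, mem_top _, rootPerm_gen j ω, ?_⟩
    refine (treeSection_gen_zero j ω).trans ?_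
    rw [offLetter, if_neg hj.symm]
    rfl
  · exact hgen _
  · exact hgen _

instance (K : Subgroup (G ω)) [K.Normal] : (sections K).Normal := by
  rw [← commutator_top_left_le_iff, ← sections_top (ω := ω)]
  exact (commutator_sections_le ⊤ K).trans (sections_mono (commutator_le_right ⊤ K))

instance (K : Subgroup (G ω)) [K.Normal] : (rigid 0 K).Normal := by
  rw [← commutator_top_right_le_iff, ← sections_top (ω := ω)]
  exact (commutator_rigid_sections_le K ⊤).trans (rigid_mono 0 (commutator_le_left K ⊤))

theorem rigid_zero_le (K : Subgroup (G ω)) [hK : K.Normal] (x : Fin 2) :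
    rigid 0 K ≤ rigid x K := by
  fin_cases x
  · exact le_rfl
  · intro h hh
    obtain ⟨g, hg, h1, h2⟩ := mem_rigid.1 hh
    obtain ⟨h3, h4⟩ := a_mul_mul_a_sections g h1
    refine mem_rigid.2 ⟨aG ω * g * (aG ω)⁻¹, hK.conj_mem g hg _, h3, fun y => ?_⟩
    refine (h4 y).trans ((h2 _).trans ?_)
    fin_cases y <;> simp

theorem mem_firstLevel_of_rigid {K : Subgroup (G ω)} {f : Fin 2 → G (shift ω)}
    (h : ∀ x, f x ∈ rigid x K) : f ∈ firstLevel K := by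
  have h1 : f = Pi.mulSingle 0 (f 0) * Pi.mulSingle 1 (f 1) := by
    funext x
    fin_cases x <;> simp
  rw [h1]
  exact mul_mem (h 0) (h 1)

theorem square_le_map_phi (K : Subgroup (G ω)) [K.Normal] {N : Subgroup (G (shift ω))}
    (h : N ≤ rigid 0 K) : square N ≤ K.map (phi ω) := by
  rw [square, map_le_iff_le_comap]
  exact fun f hf => mem_firstLevel_of_rigid fun x => rigid_zero_le K x (h (hf x trivial))

/-- The generator whose recursion takes the value `e` at the first letter of `ω` is `(1, r)` for the
corresponding generator `r` of `G_{τω}`, and conjugation by `a` turns it into `(r, 1)`. -/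
theorem normalClosure_le_rigid_top :
    normalClosure {genG (ω 0) (shift ω)} ≤ rigid 0 (⊤ : Subgroup (G ω)) := by
  refine normalClosure_le_normal ?_
  rintro _ rfl
  obtain ⟨h1, h2⟩ := a_mul_mul_a_sections (gen (ω 0) ω) (rootPerm_gen _ ω)
  refine mem_rigid.2 ⟨aG ω * genG (ω 0) ω * (aG ω)⁻¹, mem_top _, h1, fun x => (h2 x).trans ?_⟩
  fin_cases x
  · simp [treeSection_gen_one, genG]
  · simp [treeSection_gen_zero, offLetter]

theorem genG_mul_mem_sections_commutator (i : Fin 3) {h : G (shift ω)}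
    (hh : (h : TreeAut 2) = offLetter i (ω 0)) :
    genG i (shift ω) * h ∈ sections ⁅(⊤ : Subgroup (G ω)), (⊤ : Subgroup (G ω))⁆ := by
  obtain ⟨h1, h2⟩ := a_mul_mul_a_sections (gen i ω) (rootPerm_gen i ω)
  refine mem_sections.2 ⟨⁅aG ω, genG i ω⁆, commutator_mem_commutator (mem_top _) (mem_top _), ?_⟩
  have h3 : ((⁅aG ω, genG i ω⁆ : G ω) : TreeAut 2) = a * gen i ω * a⁻¹ * gen i ω := by
    rw [commutatorElement_def, inv_eq_of_mul_eq_one_left (genG_mul_self i ω)]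
    rfl
  rw [h3]
  constructor
  · rw [rootPerm_mul, h1, rootPerm_gen, one_mul]
  · rw [treeSection_mul, rootPerm_gen, Equiv.Perm.one_apply, h2, Equiv.swap_apply_left,
      treeSection_gen_one, treeSection_gen_zero, Subgroup.coe_mul, hh]
    rfl

theorem genG_mem_sections_commutator :
    genG (ω 0) (shift ω) ∈ sections ⁅(⊤ : Subgroup (G ω)), (⊤ : Subgroup (G ω))⁆ := by
  have h := genG_mul_mem_sections_commutator (ω := ω) (ω 0) (h := 1) (by simp [offLetter])
  rwa [mul_one] at h

theorem genG_mul_aG_mem_sections_commutator {i : Fin 3} (hi : i ≠ ω 0) :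
    genG i (shift ω) * aG (shift ω) ∈
      sections ⁅(⊤ : Subgroup (G ω)), (⊤ : Subgroup (G ω))⁆ :=
  genG_mul_mem_sections_commutator i (by simp [offLetter, hi.symm, aG])

theorem commutator_le_sections_commutator :
    ⁅(⊤ : Subgroup (G (shift ω))), (⊤ : Subgroup (G (shift ω)))⁆ ≤
      sections ⁅(⊤ : Subgroup (G ω)), (⊤ : Subgroup (G ω))⁆ := by
  have h := commutator_sections_le (⊤ : Subgroup (G ω)) ⊤
  rwa [sections_top] at h

/-- Let `D` be the normal closure of the generator `r` of `normalClosure_le_rigid_top` and `P` the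
group of first sections of `G'_ω`. The rigid part of `G'_ω` contains `⁅D, G_{τω}⁆`, so that of
`G''_ω` contains `⁅⁅D, G_{τω}⁆, P⁆`, and this contains `G''_{τω}` by `commutator_commutator_le`. -/
theorem derivedSeries_two_le_rigid :
    derivedSeries (G (shift ω)) 2 ≤ rigid 0 (derivedSeries (G ω) 2) := by
  obtain ⟨j, hj⟩ := exists_ne (ω 0)
  set P := sections ⁅(⊤ : Subgroup (G ω)), (⊤ : Subgroup (G ω))⁆ with hP
  have hrP : genG (ω 0) (shift ω) ∈ P := genG_mem_sections_commutator
  have hD : ⁅normalClosure {genG (ω 0) (shift ω)}, (⊤ : Subgroup (G (shift ω)))⁆ ≤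
      rigid 0 ⁅(⊤ : Subgroup (G ω)), (⊤ : Subgroup (G ω))⁆ := by
    rw [← sections_top (ω := ω)]
    exact (commutator_mono normalClosure_le_rigid_top le_rfl).trans
      (commutator_rigid_sections_le ⊤ ⊤)
  refine (commutator_commutator_le (closure_aG_genG hj (shift ω)) (aG_mul_self _)
    (genG_mul_self _ _) (genG_mul_self _ _) (normalClosure {genG (ω 0) (shift ω)}) P
    (normalClosure_le_normal (by rintro _ rfl; exact hrP)) (subset_normalClosure rfl)
    (genG_mul_aG_mem_sections_commutator hj)).trans ?_
  exact (commutator_mono hD le_rfl).trans (commutator_rigid_sections_le _ _)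

theorem third_le_rigid : third (G (shift ω)) ≤ rigid 0 (third (G ω)) := by
  have h : derivedSeries (G (shift ω)) 2 ≤ sections (derivedSeries (G ω) 2) :=
    (commutator_mono commutator_le_sections_commutator commutator_le_sections_commutator).trans
      (commutator_sections_le _ _)
  exact (commutator_mono derivedSeries_two_le_rigid h).trans (commutator_rigid_sections_le _ _)

end FirstLevel

/-! ### Level transitivity -/

theorem exists_map_cons_eq_zero_cons (ω : Omega) (x : Fin 2) (v : List (Fin 2)) :
    ∃ g ∈ G ω, g (x :: v) = 0 :: v := by
  fin_cases x
  · exact ⟨1, one_mem _, rfl⟩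
  · exact ⟨a, a_mem ω, rfl⟩

theorem levelTransitive_G (ω : Omega) : LevelTransitive (G ω) := by
  intro u
  induction u generalizing ω with
  | nil =>
    intro v hv
    obtain rfl := List.length_eq_zero_iff.1 hv.symm
    exact ⟨1, one_mem _, rfl⟩
  | cons x u ih =>
    rintro (_ | ⟨y, v⟩) hv
    · simp at hv
    · obtain ⟨h, hh, hu⟩ := ih (shift ω) v (by simpa using hv)
      obtain ⟨g, -, hg1, hg2⟩ := mem_sections.1
        ((sections_top (ω := ω)).symm ▸ Subgroup.mem_top (⟨h, hh⟩ : G (shift ω)))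
      obtain ⟨s, hs, hsu⟩ := exists_map_cons_eq_zero_cons ω x u
      obtain ⟨t, ht, htv⟩ := exists_map_cons_eq_zero_cons ω y v
      refine ⟨t⁻¹ * g * s, mul_mem (mul_mem (inv_mem ht) g.2) hs, ?_⟩
      rw [RelIso.mul_apply, RelIso.mul_apply, hsu, map_cons_eq, hg1, hg2, Equiv.Perm.one_apply]
      change t⁻¹ (0 :: h u) = y :: v
      rw [hu, ← htv, RelIso.inv_apply_self]

/-! ### Rigid stabilizers have finite index -/

section FiniteIndex

open Subgroup

/-- The stabilizer of the first level in `G_ω`. -/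
def levelStab (ω : Omega) : Subgroup (G ω) :=
  (MonoidHom.mk' (fun g : G ω => rootPerm (g : TreeAut 2))
    fun g h => rootPerm_mul (g : TreeAut 2) h).ker

instance (ω : Omega) : (levelStab ω).FiniteIndex := finiteIndex_ker _

/-- The section at `x` is a homomorphism on the stabilizer of the first level. -/
def sectionHom (ω : Omega) (x : Fin 2) : levelStab ω →* G (shift ω) :=
  MonoidHom.mk' (fun g => ⟨treeSection (g : G ω) x, treeSection_mem ω (g : G ω).2 x⟩)
    fun g h => Subtype.ext <| by
      have hh : rootPerm ((h : G ω) : TreeAut 2) = 1 := h.2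
      change treeSection (((g : G ω) : TreeAut 2) * ((h : G ω) : TreeAut 2)) x = _
      rw [treeSection_mul, hh]
      rfl

variable {ω : Omega}

theorem sections_eq_map_sectionHom (K : Subgroup (G ω)) :
    sections K = (K.subgroupOf (levelStab ω)).map (sectionHom ω 0) := by
  ext h
  rw [mem_sections]
  constructor
  · rintro ⟨g, hg, h1, h2⟩
    exact ⟨⟨g, h1⟩, hg, Subtype.ext h2⟩
  · rintro ⟨g, hg, rfl⟩
    exact ⟨g, hg, g.2, rfl⟩

instance (K : Subgroup (G ω)) [K.FiniteIndex] : (sections K).FiniteIndex := by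
  rw [sections_eq_map_sectionHom]
  refine finiteIndex_map_of_surjective ?_ _
  rw [← MonoidHom.range_eq_top, MonoidHom.range_eq_map, ← subgroupOf_self,
    ← sections_top (ω := ω), sections_eq_map_sectionHom, top_subgroupOf, subgroupOf_self]

theorem shift_mem_OmegaInf (hω : ω ∈ OmegaInf) : shift ω ∈ OmegaInf := by
  intro i
  refine Set.infinite_of_forall_exists_gt fun m => ?_
  obtain ⟨n, hn, hmn⟩ := (hω i).exists_gt (m + 1)
  obtain ⟨k, rfl⟩ : ∃ k, n = k + 1 := ⟨n - 1, by omega⟩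
  exact ⟨k, hn, by omega⟩

/-- With `r` as in `normalClosure_le_rigid_top` and `D` its normal closure, of finite index in
`G_{τω}`, the rigid part of `K` contains `⁅D, sections K⁆`. -/
theorem finiteIndex_rigid (hω : ω ∈ OmegaInf) (K : Subgroup (G ω)) [K.Normal] [K.FiniteIndex] :
    (rigid 0 K).FiniteIndex := by
  obtain ⟨j, hj⟩ := exists_ne (ω 0)
  obtain ⟨n, hn⟩ := (shift_mem_OmegaInf hω j).nonempty
  have hD : (normalClosure {genG (ω 0) (shift ω)}).FiniteIndex :=
    finiteIndex_normalClosure_of_involutions (closure_aG_genG hj (shift ω)) (aG_mul_self _)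
      (genG_mul_self _ _) (genG_mul_self _ _) (isOfFinOrder_genG_mul_aG hn)
  have hr : IsOfFinOrder (genG (ω 0) (shift ω)) :=
    isOfFinOrder_iff_pow_eq_one.2 ⟨2, two_pos, by rw [pow_two, genG_mul_self]⟩
  have := finiteIndex_commutator_normalClosure hr (sections K)
  exact finiteIndex_of_le ((commutator_mono normalClosure_le_rigid_top le_rfl).trans
    ((commutator_rigid_sections_le ⊤ K).trans (rigid_mono 0 (commutator_le_right ⊤ K))))

/-- The subgroup of `K` generated by the intersections of `K` with the rigid stabilizers of the
vertices of level `n`. -/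
def ristLevelIn (K : Subgroup (G ω)) (n : ℕ) : Subgroup (G ω) :=
  ⨆ (v : List (Fin 2)) (_ : v.length = n), rist (G ω) v ⊓ K

theorem rist_inf_rigid_le (K : Subgroup (G ω)) (x : Fin 2) (v : List (Fin 2)) :
    rist (G (shift ω)) v ⊓ rigid x K ≤ rigid x (rist (G ω) (x :: v) ⊓ K) := by
  rintro h ⟨hv, hK⟩
  obtain ⟨g, hg, h1, h2⟩ := mem_rigid.1 hK
  refine mem_rigid.2 ⟨g, ⟨?_, hg⟩, h1, h2⟩
  rintro (_ | ⟨y, w⟩) hw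
  · exact absurd (TreeAut.map_nil _) hw
  · change (g : TreeAut 2) (y :: w) ≠ y :: w at hw
    change x :: v <+: y :: w
    rw [map_cons_eq, h1, h2, Equiv.Perm.one_apply] at hw
    by_cases hxy : y = x
    · subst hxy
      rw [Pi.mulSingle_eq_same] at hw
      exact List.cons_prefix_cons.2 ⟨rfl, hv fun h3 => hw (congrArg _ h3)⟩
    · rw [Pi.mulSingle_eq_of_ne hxy] at hw
      exact absurd rfl hw

theorem ristLevelIn_rigid_le (K : Subgroup (G ω)) [K.Normal] (n : ℕ) (x : Fin 2) :
    ristLevelIn (rigid 0 K) n ≤ rigid x (ristLevelIn K (n + 1)) := by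
  refine iSup₂_le fun v hv => ?_
  refine (inf_le_inf le_rfl (rigid_zero_le K x)).trans ((rist_inf_rigid_le K x v).trans ?_)
  exact rigid_mono x (le_iSup₂_of_le (x :: v) (by rw [List.length_cons, hv]) le_rfl)

theorem finiteIndex_of_rigid (L : Subgroup (G ω)) (M : Subgroup (G (shift ω))) [M.FiniteIndex]
    (h : ∀ x, M ≤ rigid x L) : L.FiniteIndex := by
  let J : Subgroup (levelStab ω) := ⨅ x, M.comap (sectionHom ω x)
  have hJ : J.FiniteIndex := finiteIndex_iInf fun x =>
    ⟨by rw [index_comap]; exact (instFiniteIndex_subgroupOf M _).index_ne_zero⟩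
  have hJ' : (J.map (levelStab ω).subtype).FiniteIndex :=
    ⟨by rw [index_map_subtype]; exact mul_ne_zero hJ.index_ne_zero FiniteIndex.index_ne_zero⟩
  refine finiteIndex_of_le (H := J.map (levelStab ω).subtype) ?_
  rintro _ ⟨g, hg, rfl⟩
  have hmem : (fun x => sectionHom ω x g) ∈ firstLevel L :=
    mem_firstLevel_of_rigid fun x => h x (mem_iInf.1 hg x)
  obtain ⟨k, hk, h1, h2⟩ := mem_firstLevel.1 hmem
  have hkg : k = (levelStab ω).subtype g := Subtype.ext (treeAut_ext (h1.trans g.2.symm) h2)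
  exact hkg ▸ hk

/-- Induction on the level, over all normal subgroups `K` of finite index at once: `ristLevelIn K`
at level `n + 1` contains the square of `ristLevelIn (rigid 0 K)` at level `n`. -/
theorem finiteIndex_ristLevelIn (n : ℕ) : ∀ {ω : Omega}, ω ∈ OmegaInf →
    ∀ (K : Subgroup (G ω)) [K.Normal] [K.FiniteIndex], (ristLevelIn K n).FiniteIndex := by
  induction n with
  | zero =>
    intro ω _ K _ _
    refine finiteIndex_of_le (H := K) (le_iSup₂_of_le [] rfl fun g hg => ⟨?_, hg⟩)
    exact fun w _ => List.nil_prefix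
  | succ n ih =>
    intro ω hω K _ _
    have := finiteIndex_rigid hω K
    have := ih (shift_mem_OmegaInf hω) (rigid 0 K)
    exact finiteIndex_of_rigid _ _ (ristLevelIn_rigid_le K n)

theorem isBranch_G (hω : ω ∈ OmegaInf) : IsBranch (G ω) := by
  refine ⟨levelTransitive_G ω, fun n _ => ?_⟩
  have := finiteIndex_ristLevelIn n hω ⊤
  exact finiteIndex_of_le (H := ristLevelIn ⊤ n) (iSup₂_mono fun v _ => inf_le_left)

end FiniteIndex

end GrigBranch

theorem mainTheorem7 :
    (∀ ω : GrigBranch.Omega,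
      GrigBranch.square (GrigBranch.third (GrigBranch.G (GrigBranch.shift ω))) ≤
        (GrigBranch.third (GrigBranch.G ω)).map (GrigBranch.phi ω)) ∧
    (∀ ω ∈ GrigBranch.OmegaInf, GrigBranch.IsBranch (GrigBranch.G ω)) := by
  exact ⟨fun _ => GrigBranch.square_le_map_phi _ GrigBranch.third_le_rigid,
    fun _ => GrigBranch.isBranch_G⟩
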